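/- Theorem (Satisfiability of the Solved Form). Let $\mathbb{T}$ be one of the theories List, MSet, CList, Set. Let $\mathcal{F}$ be a signature consisting of a constant $\mathtt{nil}$, a binary aggregate constructor written $\{\cdot\,|\,\cdot\}$ (with $\{s_1,\dots,s_n\,|\,t\} = \{s_1\,|\,\{s_2\,|\cdots\{s_n\,|\,t\}\cdots\}\}$), and arbitrarily many further constant and function symbols, and let $\mathcal V$ be an infinite set of variables. Let $E_{\mathbb T}$ be the equational theory with no axiom for List, with the permutativity axiom $\forall xyz\,(\{x,y\,|\,z\}=\{y,x\,|\,z\})$ for MSet, with the absorption axiom $\forall xy\,(\{x,x\,|\,y\}=\{x\,|\,y\})$ for CList, and with both axioms for Set. The privileged model $\mathcal A_{\mathbb T}$ ($\mathcal{LIST}$, $\mathcal{MSET}$, $\mathcal{CLIST}$, $\mathcal{SET}$) is the quotient of the set of ground terms by the smallest congruence $\equiv_{\mathbb T}$ induced by $E_{\mathbb T}$; function symbols are interpreted by the term operations on classes, $=$ is identity, and $[t]\in[s]$ holds if and only if some term in the class $[s]$ has the form $\{t_1,\dots,t_n,t\,|\,r\}$, $n\ge 0$. A constraint is a finite conjunction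 $C=c_1\wedge\dots\wedge c_n$ of literals $s=t$, $s\in t$, $s\ne t$, $s\notin t$ between terms over $\mathcal F$ and $\mathcal V$. It is in pre-solved form if each $c_i$ is of the form $X=t$ with the variable $X$ occurring neither in $t$ nor in any other conjunct, or of one of the forms $t\in X$, $X\ne t$, $t\notin X$ with the variable $X$ not occurring in $t$. It is acyclic if the directed graph on variables with an edge from each variable of $t$ to $X$, for every conjunct $t\in X$, has no directed cycle. If $X_1,\dots,X_q$ are the variables on the right-hand sides of the membership atoms of $C$, and $t_i^1\in X_i,\dots,t_i^{k_i}\in X_i$ are all the atoms with right-hand side $X_i$, then the member substitution is $\sigma_C=[X_i/\{F_i,t_i^1,\dots,t_i^{k_i}\,|\,M_i\}]_{i\le q}$, where the $F_i,M_i$ are pairwise distinct new variables not occurring in $C$. For a substitution $\theta=[X_i/t_i]_i$ put $\theta^1=\theta$ and $\theta^{m+1}=[X_i/\theta^m(t_i)]_i$; $\theta$ is stabilizing if $\theta^{m+1}=\theta^m$ for some $m>0$, and then its closure $\theta^*$ is the eventually constant value of $\theta^m$ (for $C$ pre-solved and acyclic, $\sigma_C$ is stabilizing). A pre-solved acyclic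 constraint $C$ is in solved form if for each pair of conjuncts $t\notin X$, $t'\in X$ of $C$ (with the same $X$) one has $E_{\mathbb T}\not\models\forall\,(\sigma_C^*(t)=\sigma_C^*(t'))$. Then every constraint $C$ in solved form is satisfiable in the privileged model of its theory: $\mathcal A_{\mathbb T}\models\exists C$; that is, $\mathcal{LIST}\models\exists C$, $\mathcal{MSET}\models\exists C$, $\mathcal{CLIST}\models\exists C$, $\mathcal{SET}\models\exists C$, respectively. -/

import Mathlib

/-!
Constraints over lists, multisets, compact lists and sets: first-order language, equational
theories, privileged models, and solved form.
-/

namespace Aggregates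

section

open FirstOrder FirstOrder.Language

universe u v

/-- The four kinds of aggregates: lists, multisets, compact lists, sets. -/
inductive Agg : Type
  | list
  | mset
  | clist
  | set

/-- The theories whose aggregate constructor is permutative. -/
def Agg.IsPermutative : Agg → Prop
  | .list => False
  | .mset => True
  | .clist => False
  | .set => True

/-- The theories whose aggregate constructor is absorptive. -/
def Agg.IsAbsorptive : Agg → Prop
  | .list => False
  | .mset => False
  | .clist => True
  | .set => True

/-- Function symbols: `nil`, the binary aggregate constructor, and an arbitrary family `Fn` of
further constant and function symbols (`Fn n` are those of arity `n`). -/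
inductive FunSym (Fn : ℕ → Type u) : ℕ → Type u
  | nil : FunSym Fn 0
  | cons : FunSym Fn 2
  | free {n : ℕ} (f : Fn n) : FunSym Fn n

/-- The only predicate symbol besides equality: the binary membership symbol. -/
inductive RelSym : ℕ → Type
  | mem : RelSym 2

/-- The first-order language of aggregates over the further symbols `Fn`. -/
abbrev lang (Fn : ℕ → Type u) : FirstOrder.Language.{u, 0} where
  Functions := FunSym Fn
  Relations := RelSym

variable {Fn : ℕ → Type u} {α β : Type v}

/-- The symbol `nil`. -/
def nilSym : (lang Fn).Functions 0 := FunSym.nil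

/-- The aggregate constructor symbol. -/
def consSym : (lang Fn).Functions 2 := FunSym.cons

/-- The membership symbol. -/
def memSym : (lang Fn).Relations 2 := RelSym.mem

/-- The constant term `nil`. -/
def nil : (lang Fn).Term α :=
  .func nilSym ![]

/-- The term `[s | t]` (resp. for the other aggregates). -/
def cons (s t : (lang Fn).Term α) : (lang Fn).Term α :=
  .func consSym ![s, t]

/-- The term `[s₁, …, sₙ | r]` (resp. for the other aggregates). -/
def consList (ts : List ((lang Fn).Term α)) (r : (lang Fn).Term α) : (lang Fn).Term α :=
  ts.foldr cons r

/-! ### Equational theories -/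

/-- Permutativity: `∀ x y z, {x, y | z} = {y, x | z}`. -/
def permAxiom (Fn : ℕ → Type u) : (lang Fn).Sentence :=
  ∀' ∀' ∀' (Term.bdEqual (cons (&0) (cons (&1) (&2))) (cons (&1) (cons (&0) (&2))) :
    (lang Fn).BoundedFormula Empty 3)

/-- Absorption: `∀ x y, {x, x | y} = {x | y}`. -/
def absAxiom (Fn : ℕ → Type u) : (lang Fn).Sentence :=
  ∀' ∀' (Term.bdEqual (cons (&0) (cons (&0) (&1))) (cons (&0) (&1)) :
    (lang Fn).BoundedFormula Empty 2)

/-- The equational theory `E_T`. -/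
def eqTheory (Fn : ℕ → Type u) (T : Agg) : (lang Fn).Theory :=
  {φ | (T.IsPermutative ∧ φ = permAxiom Fn) ∨ (T.IsAbsorptive ∧ φ = absAxiom Fn)}

/-! ### Privileged models -/

/-- The Herbrand universe: ground terms. -/
abbrev Herbrand (Fn : ℕ → Type u) : Type u := (lang Fn).Term Empty

/-- The smallest congruence on ground terms that contains the ground instances of the axioms of
`E_T`. -/
inductive Equ (T : Agg) : Herbrand Fn → Herbrand Fn → Prop
  | refl (t) : Equ T t t
  | symm {s t} : Equ T s t → Equ T t s
  | trans {r s t} : Equ T r s → Equ T s t → Equ T r t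
  | congr {n : ℕ} (f : (lang Fn).Functions n) (ss ts : Fin n → Herbrand Fn) :
      (∀ i, Equ T (ss i) (ts i)) → Equ T (.func f ss) (.func f ts)
  | perm (h : T.IsPermutative) (x y z) : Equ T (cons x (cons y z)) (cons y (cons x z))
  | abs (h : T.IsAbsorptive) (x y) : Equ T (cons x (cons x y)) (cons x y)

/-- The congruence of `E_T` as a setoid. -/
def herbrandSetoid (Fn : ℕ → Type u) (T : Agg) : Setoid (Herbrand Fn) where
  r := Equ T
  iseqv := ⟨Equ.refl, Equ.symm, Equ.trans⟩

/-- Membership between ground terms: some term equivalent to `s` has the form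
`[t₁, …, tₙ, t | r]`. -/
def MemGround (T : Agg) (t s : Herbrand Fn) : Prop :=
  ∃ (ts : List (Herbrand Fn)) (r : Herbrand Fn), Equ T (consList (ts ++ [t]) r) s

theorem Equ.cons_congr {T : Agg} {s s' t t' : Herbrand Fn} (hs : Equ T s s') (ht : Equ T t t') :
    Equ T (cons s t) (cons s' t') := by
  refine Equ.congr _ _ _ fun i => ?_
  fin_cases i
  · exact hs
  · exact ht

theorem Equ.consList_append_congr {T : Agg} {t t' : Herbrand Fn} (h : Equ T t t')
    (ts : List (Herbrand Fn)) (r : Herbrand Fn) :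
    Equ T (consList (ts ++ [t]) r) (consList (ts ++ [t']) r) := by
  induction ts with
  | nil => exact h.cons_congr (.refl _)
  | cons a ts ih => exact (Equ.refl a).cons_congr ih

theorem MemGround.congr {T : Agg} {t t' s s' : Herbrand Fn} (ht : Equ T t t') (hs : Equ T s s')
    (h : MemGround T t s) : MemGround T t' s' := by
  obtain ⟨ts, r, h⟩ := h
  exact ⟨ts, r, (ht.symm.consList_append_congr ts r).trans (h.trans hs)⟩

/-- Function symbols act on ground terms freely; the membership symbol acts as `MemGround`. -/
instance herbrandPrestructure (Fn : ℕ → Type u) (T : Agg) :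
    (lang Fn).Prestructure (herbrandSetoid Fn T) where
  toStructure :=
    { funMap := fun f ts => .func f ts
      RelMap := fun {n} (R : RelSym n) =>
        match R with
        | .mem => fun ts => MemGround T (ts 0) (ts 1) }
  fun_equiv := fun x y h => Equ.congr _ x y h
  rel_equiv := by
    intro n R x y h
    cases R with
    | mem =>
      exact propext ⟨MemGround.congr (h 0) (h 1),
        MemGround.congr (h 0).symm (h 1).symm⟩

/-- The privileged model: ground terms modulo `E_T`, with the structure induced on the quotient
(`FirstOrder.Language.quotientStructure`). -/
abbrev PrivModel (Fn : ℕ → Type u) (T : Agg) : Type u := Quotient (herbrandSetoid Fn T)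

/-! ### Constraints -/

/-- Literals `s = t`, `s ∈ t`, `s ≠ t`, `s ∉ t`. -/
inductive Literal (Fn : ℕ → Type u) (V : Type v) : Type (max u v)
  | eq (s t : (lang Fn).Term V)
  | mem (s t : (lang Fn).Term V)
  | ne (s t : (lang Fn).Term V)
  | nmem (s t : (lang Fn).Term V)

/-- A constraint is a finite conjunction of literals, given as the list of its conjuncts. -/
abbrev Constraint (Fn : ℕ → Type u) (V : Type v) : Type (max u v) := List (Literal Fn V)

/-- The atomic formula `s ∈ t`. -/
def memFormula (s t : (lang Fn).Term α) : (lang Fn).Formula α :=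
  Relations.formula₂ memSym s t

/-- A literal as a first-order formula. -/
def Literal.toFormula : Literal Fn α → (lang Fn).Formula α
  | .eq s t => Term.equal s t
  | .mem s t => memFormula s t
  | .ne s t => ∼ (Term.equal s t)
  | .nmem s t => ∼ (memFormula s t)

/-- A constraint as a first-order formula: the conjunction of its literals. -/
def Constraint.toFormula (C : Constraint Fn α) : (lang Fn).Formula α :=
  (C.map Literal.toFormula).foldr (· ⊓ ·) ⊤

/-- `C` is satisfiable in the privileged model of `T`. -/
def Constraint.Satisfiable (T : Agg) (C : Constraint Fn α) : Prop :=
  ∃ γ : α → PrivModel Fn T, C.toFormula.Realize γ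

/-! ### Pre-solved form and acyclicity -/

variable [DecidableEq α]

/-- The variables of a literal. -/
def Literal.vars : Literal Fn α → Finset α
  | .eq s t => s.varFinset ∪ t.varFinset
  | .mem s t => s.varFinset ∪ t.varFinset
  | .ne s t => s.varFinset ∪ t.varFinset
  | .nmem s t => s.varFinset ∪ t.varFinset

/-- The variable `X` occurs in the constraint `C`. -/
def Constraint.Occurs (X : α) (C : Constraint Fn α) : Prop :=
  ∃ c ∈ C, X ∈ c.vars

/-- Every conjunct is of the form `X = t` with `X` occurring neither in `t` nor in any other
conjunct, or `t ∈ X`, `X ≠ t` or `t ∉ X` with `X` not occurring in `t`. -/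
def Constraint.PreSolved (C : Constraint Fn α) : Prop :=
  ∀ i : Fin C.length, ∃ (X : α) (t : (lang Fn).Term α), X ∉ t.varFinset ∧
    ((C.get i = .eq (.var X) t ∧ ∀ j : Fin C.length, j ≠ i → X ∉ (C.get j).vars) ∨
      C.get i = .mem t (.var X) ∨
      C.get i = .ne (.var X) t ∨
      C.get i = .nmem t (.var X))

/-- The edges of the membership graph: an edge from each variable of `t` to `X` whenever `t ∈ X`
is a conjunct. -/
def Constraint.Edge (C : Constraint Fn α) (Y X : α) : Prop :=
  ∃ t : (lang Fn).Term α, Literal.mem t (.var X) ∈ C ∧ Y ∈ t.varFinset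

/-- The membership graph has no directed cycle. -/
def Constraint.Acyclic (C : Constraint Fn α) : Prop :=
  ∀ X : α, ¬ Relation.TransGen C.Edge X X

/-! ### Closure of substitutions -/

/-- Substitutions; variables outside the domain are sent to themselves. -/
abbrev Subst (Fn : ℕ → Type u) (V : Type v) : Type (max u v) := V → (lang Fn).Term V

/-- Powers: `σ ^ (m + 1)` sends `X` to the image of `σ X` under `σ ^ m`, where `σ ^ 0` is the
identity substitution (so that `σ ^ 1 = σ`). -/
def Subst.pow (σ : Subst Fn β) : ℕ → Subst Fn β
  | 0 => fun X => .var X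
  | m + 1 => fun X => (σ X).subst (Subst.pow σ m)

theorem Subst.pow_one (σ : Subst Fn β) : σ.pow 1 = σ := by
  have key : ∀ t : (lang Fn).Term β, t.subst (fun X => .var X) = t := by
    intro t
    induction t with
    | var => rfl
    | func f ts ih => simp only [Term.subst, ih]
  funext X
  exact key (σ X)

/-- `σ` is stabilizing: `σ ^ (m + 1) = σ ^ m` for some `m > 0`. -/
def Subst.Stabilizing (σ : Subst Fn β) : Prop :=
  ∃ m : ℕ, 0 < m ∧ σ.pow (m + 1) = σ.pow m

open Classical in
/-- The closure of a stabilizing substitution: the power at which the sequence of powers becomes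
constant (for other substitutions, an irrelevant value). -/
noncomputable def Subst.closure (σ : Subst Fn β) : Subst Fn β :=
  if h : σ.Stabilizing then σ.pow h.choose else σ

theorem Subst.pow_eq_of_le {σ : Subst Fn β} {m : ℕ} (h : σ.pow (m + 1) = σ.pow m) :
    ∀ k, m ≤ k → σ.pow k = σ.pow m := by
  intro k hk
  induction k, hk using Nat.le_induction with
  | base => rfl
  | succ k _ ih =>
    rw [← h]
    funext X
    simp only [Subst.pow, ih]

theorem Subst.closure_spec {σ : Subst Fn β} (h : σ.Stabilizing) :
    ∃ m : ℕ, 0 < m ∧ σ.closure = σ.pow m ∧ ∀ k, m < k → σ.pow k = σ.pow m := by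
  refine ⟨h.choose, h.choose_spec.1, ?_, fun k hk => pow_eq_of_le h.choose_spec.2 k hk.le⟩
  rw [Subst.closure, dif_pos h]

/-! ### Member substitution, membership consistency, solved form -/

/-- The terms `t₁, …, tₖ`, in order, for which `tᵢ ∈ X` is a conjunct of `C`. -/
def Constraint.members (C : Constraint Fn α) (X : α) : List ((lang Fn).Term α) :=
  C.filterMap fun
    | .mem t (.var Y) => if Y = X then some t else none
    | _ => none

/-- `F X` and `M X`, for the variables `X` on the right-hand side of a membership atom, are
pairwise different variables that do not occur in `C`. -/
structure Constraint.Fresh (C : Constraint Fn α) (F M : α → α) : Prop where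
  F_new : ∀ X, C.members X ≠ [] → ¬ C.Occurs (F X)
  M_new : ∀ X, C.members X ≠ [] → ¬ C.Occurs (M X)
  F_inj : ∀ X Y, C.members X ≠ [] → C.members Y ≠ [] → F X = F Y → X = Y
  M_inj : ∀ X Y, C.members X ≠ [] → C.members Y ≠ [] → M X = M Y → X = Y
  F_ne_M : ∀ X Y, C.members X ≠ [] → C.members Y ≠ [] → F X ≠ M Y

/-- The member substitution: `X ↦ [F X, t₁, …, tₖ | M X]`, where `t₁ ∈ X, …, tₖ ∈ X` (`k ≥ 1`)
are the membership atoms with right-hand side `X`. -/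
def Constraint.memberSubst (C : Constraint Fn α) (F M : α → α) : Subst Fn α := fun X =>
  if C.members X = [] then .var X
  else consList (.var (F X) :: C.members X) (.var (M X))

/-- Membership consistency: for conjuncts `t ∉ X` and `t' ∈ X`, the theory `E_T` does not entail
the universal closure of `σ* t = σ* t'`, where `σ` is the member substitution built with new
variables `F X`, `M X` (whose choice is immaterial). -/
def Constraint.MembershipConsistent (T : Agg) (C : Constraint Fn α) : Prop :=
  ∃ F M : α → α, C.Fresh F M ∧
    ∀ (X : α) (t t' : (lang Fn).Term α),
      Literal.nmem t (.var X) ∈ C → Literal.mem t' (.var X) ∈ C →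
        ¬ (eqTheory Fn T ⊨ᵇ Term.equal (t.subst (C.memberSubst F M).closure)
            (t'.subst (C.memberSubst F M).closure))

/-- Solved form: pre-solved form, acyclic, and membership consistent. -/
structure Constraint.Solved (T : Agg) (C : Constraint Fn α) : Prop where
  preSolved : C.PreSolved
  acyclic : C.Acyclic
  consistent : C.MembershipConsistent T

end

end Aggregates

/-!
The value of a variable `X` is built in two steps. The closure `σ*` of the member substitution turns
every term of the constraint into an open term, and makes all conjuncts `t ∈ X` true whatever the
remaining variables stand for. Then a *generic* ground substitution `θ` is applied, one that keeps
apart all pairs from a given finite list of open terms that are not equal modulo `E_T`, and that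
gives no variable a value with one of these terms as an element (`exists_generic_subst`).

Such a `θ` sends the `n`-th variable to a singleton `{v | nil}` with `v` of rank `N * (n + 1)`, where
the rank (the nesting depth) is invariant under both axioms and `N` exceeds the ranks of the terms
considered. The instance of a small term never has a positive multiple of `N` as its rank. So the variables can be read back from the instance, by a function `decode` that is
compatible with the congruences (`Equ.decode`, `decode_subst_code`).

The negative conjuncts are thereby reduced to open terms. For `X ≠ t`, the ends of `σ* X` and `σ* t`
are compared: `σ*` is injective on the variables of the constraint even when only ends are looked at
(`Constraint.tailVar_closure_inj`), and the end of an open term is invariant under the axioms. For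
`t ∉ X`, the elements of the value of `X` are `θ (F X)`, excluded by the newness of `F X`, the
instances of the `t'` with `t' ∈ X`, excluded by membership consistency and soundness
(`TermEq.models`), and the element of the value of a variable, excluded by genericity. The conjuncts
`X = t` are satisfied at the end, as `X` occurs nowhere else (`Constraint.PreSolved.satisfiable`).
-/

namespace Aggregates

open FirstOrder FirstOrder.Language

universe u v w

/-! ### Terms, ranks and ends of aggregates -/

section Terms

variable {Fn : ℕ → Type u} {α : Type v} {β : Type w}

@[simp]
theorem nil_subst (θ : α → (lang Fn).Term β) : (nil : (lang Fn).Term α).subst θ = nil := by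
  simp only [nil, Term.subst]
  congr 1
  exact Subsingleton.elim _ _

@[simp]
theorem cons_subst (s t : (lang Fn).Term α) (θ : α → (lang Fn).Term β) :
    (cons s t).subst θ = cons (s.subst θ) (t.subst θ) := by
  simp only [cons, Term.subst]
  congr 1
  funext i
  fin_cases i <;> rfl

@[simp]
theorem nil_relabel (g : α → β) : (nil : (lang Fn).Term α).relabel g = nil := by
  simp only [nil, Term.relabel]
  congr 1
  exact Subsingleton.elim _ _

@[simp]
theorem cons_relabel (s t : (lang Fn).Term α) (g : α → β) :
    (cons s t).relabel g = cons (s.relabel g) (t.relabel g) := by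
  simp only [cons, Term.relabel]
  congr 1
  funext i
  fin_cases i <;> rfl

theorem consList_subst (ts : List ((lang Fn).Term α)) (r : (lang Fn).Term α)
    (θ : α → (lang Fn).Term β) :
    (consList ts r).subst θ = consList (ts.map fun t => t.subst θ) (r.subst θ) := by
  induction ts with
  | nil => rfl
  | cons a ts ih => exact (cons_subst _ _ _).trans (congrArg _ ih)

/-- Structural induction on terms in which `nil`, the aggregate constructor and the further
symbols are separate cases. -/
theorem term_induction {P : (lang Fn).Term α → Prop} (var : ∀ x, P (.var x)) (nil : P nil)
    (cons : ∀ s t, P s → P t → P (cons s t))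
    (free : ∀ {n : ℕ} (f : Fn n) (ts : Fin n → (lang Fn).Term α), (∀ i, P (ts i)) →
      P (.func (FunSym.free f) ts)) : ∀ t, P t := by
  intro t
  induction t with
  | var x => exact var x
  | @func n f ts ih =>
    cases (f : FunSym Fn n) with
    | nil =>
      have : ts = ![] := Subsingleton.elim _ _
      rw [this]
      exact nil
    | cons =>
      have : ts = ![ts 0, ts 1] := by
        funext i
        fin_cases i <;> rfl
      rw [this]
      exact cons _ _ (ih 0) (ih 1)
    | free f => exact free f ts ih

/-- Case distinction on a function symbol applied to arguments from an arbitrary type. -/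
def FunSym.elim {A B : Type*} (nil : B) (cons : A → A → B)
    (free : ∀ {n : ℕ}, Fn n → (Fin n → A) → B) : ∀ {n : ℕ}, FunSym Fn n → (Fin n → A) → B
  | _, .nil, _ => nil
  | _, .cons, a => cons (a 0) (a 1)
  | _, .free f, a => free f a

/-- The rank of a term: every nesting adds one, but prepending an element to an aggregate does
not, so that the rank is insensitive to the order and the multiplicity of elements. -/
def rank : (lang Fn).Term α → ℕ
  | .var _ => 0
  | .func f ts =>
    FunSym.elim (B := ℕ) 0 (fun a b => max (a + 1) b) (fun _ r => Finset.univ.sup r + 1) f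
      (fun i => rank (ts i))

@[simp]
theorem rank_nil : rank (nil : (lang Fn).Term α) = 0 := rfl

@[simp]
theorem rank_cons (s t : (lang Fn).Term α) : rank (cons s t) = max (rank s + 1) (rank t) := rfl

@[simp]
theorem rank_free {n : ℕ} (f : Fn n) (ts : Fin n → (lang Fn).Term α) :
    rank (.func (FunSym.free f) ts) = (Finset.univ.sup fun i => rank (ts i)) + 1 := rfl

/-- The variable at the end of the outermost aggregate `{s₁, …, sₙ | X}`, if there is one. -/
def tailVar : (lang Fn).Term α → Option α
  | .var x => some x
  | .func f ts => FunSym.elim none (fun _ b => b) (fun _ _ => none) f (fun i => tailVar (ts i))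

/-- Replaces the end `r` of the outermost aggregate `{s₁, …, sₙ | r}` by the variable `n`, or by
the larger of the two variables if `r` is already one. Taking the larger one makes these
operations commute. -/
def setTail (n : ℕ) : (lang Fn).Term ℕ → (lang Fn).Term ℕ
  | .var m => .var (max n m)
  | .func f ts =>
    FunSym.elim (.var n) (fun a b => cons a.1 b.2) (fun _ _ => .var n) f
      (fun i => (ts i, setTail n (ts i)))

@[simp]
theorem setTail_cons (n : ℕ) (s t : (lang Fn).Term ℕ) :
    setTail n (cons s t) = cons s (setTail n t) := rfl

/-- Reads a ground term back as an open term: an element of rank `N * (n + 1)` is taken as the mark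
that the aggregate ends in the variable `n`. The test looks at ranks only, so it does not depend on
the representative modulo `E_T`. -/
def decode (N : ℕ) : Herbrand Fn → (lang Fn).Term ℕ
  | .var x => x.elim
  | .func f ts =>
    FunSym.elim nil
      (fun a b => if N ∣ a.1 ∧ a.1 ≠ 0 then setTail (a.1 / N - 1) b.2 else cons a.2 b.2)
      (fun g a => .func (FunSym.free g) fun i => (a i).2) f
      (fun i => (rank (ts i), decode N (ts i)))

@[simp]
theorem decode_cons (N : ℕ) (s t : Herbrand Fn) : decode N (cons s t) =
    if N ∣ rank s ∧ rank s ≠ 0 then setTail (rank s / N - 1) (decode N t)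
      else cons (decode N s) (decode N t) := rfl

/-- `a` is equivalent to one of the elements `sᵢ` of the outermost aggregate `{s₁, …, sₙ | r}`. -/
def IsElem (T : Agg) (a : Herbrand Fn) : Herbrand Fn → Prop
  | .var x => x.elim
  | .func f ts =>
    FunSym.elim False (fun x y => Equ T a x.1 ∨ y.2) (fun _ _ => False) f
      (fun i => (ts i, IsElem T a (ts i)))

@[simp]
theorem isElem_cons (T : Agg) (a s t : Herbrand Fn) :
    IsElem T a (cons s t) ↔ Equ T a s ∨ IsElem T a t := Iff.rfl


end Terms

/-! ### Equality of open terms modulo the axioms -/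

section TermEq

variable {Fn : ℕ → Type u} {α : Type v} {β : Type w} {T : Agg}

/-- The smallest congruence on open terms that contains all instances of the axioms of `E_T`. -/
inductive TermEq (T : Agg) : (lang Fn).Term α → (lang Fn).Term α → Prop
  | refl (t) : TermEq T t t
  | symm {s t} : TermEq T s t → TermEq T t s
  | trans {r s t} : TermEq T r s → TermEq T s t → TermEq T r t
  | congr {n : ℕ} (f : (lang Fn).Functions n) (ss ts : Fin n → (lang Fn).Term α) :
      (∀ i, TermEq T (ss i) (ts i)) → TermEq T (.func f ss) (.func f ts)
  | perm (h : T.IsPermutative) (x y z) : TermEq T (cons x (cons y z)) (cons y (cons x z))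
  | abs (h : T.IsAbsorptive) (x y) : TermEq T (cons x (cons x y)) (cons x y)

theorem TermEq.cons_congr {s s' t t' : (lang Fn).Term α} (hs : TermEq T s s')
    (ht : TermEq T t t') : TermEq T (cons s t) (cons s' t') := by
  refine TermEq.congr _ _ _ fun i => ?_
  fin_cases i
  · exact hs
  · exact ht

theorem TermEq.relabel {s t : (lang Fn).Term α} (g : α → β) (h : TermEq T s t) :
    TermEq T (s.relabel g) (t.relabel g) := by
  induction h with
  | refl t => exact .refl _
  | symm _ ih => exact ih.symm
  | trans _ _ ih₁ ih₂ => exact ih₁.trans ih₂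
  | congr f ss ts _ ih => exact .congr f _ _ ih
  | perm h x y z => simpa only [cons_relabel] using TermEq.perm h _ _ _
  | abs h x y => simpa only [cons_relabel] using TermEq.abs h _ _

theorem realize_cons {M : Type*} [(lang Fn).Structure M] (v : α → M) (s t : (lang Fn).Term α) :
    (cons s t).realize v =
      Structure.funMap (consSym : (lang Fn).Functions 2) ![s.realize v, t.realize v] := by
  simp only [cons, Term.realize]
  congr 1
  funext i
  fin_cases i <;> rfl

theorem realize_permAxiom {M : Type*} [(lang Fn).Structure M] (h : M ⊨ permAxiom Fn) (x y z : M) :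
    Structure.funMap (consSym : (lang Fn).Functions 2)
        ![x, Structure.funMap (consSym : (lang Fn).Functions 2) ![y, z] ] =
      Structure.funMap (consSym : (lang Fn).Functions 2)
        ![y, Structure.funMap (consSym : (lang Fn).Functions 2) ![x, z] ] := by
  have := h x y z
  rw [BoundedFormula.realize_bdEqual] at this
  simp only [realize_cons] at this
  exact this

theorem realize_absAxiom {M : Type*} [(lang Fn).Structure M] (h : M ⊨ absAxiom Fn) (x y : M) :
    Structure.funMap (consSym : (lang Fn).Functions 2)
        ![x, Structure.funMap (consSym : (lang Fn).Functions 2) ![x, y] ] =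
      Structure.funMap (consSym : (lang Fn).Functions 2) ![x, y] := by
  have := h x y
  rw [BoundedFormula.realize_bdEqual] at this
  simp only [realize_cons] at this
  exact this

/-- Soundness of equational reasoning. -/
theorem TermEq.realize_eq {s t : (lang Fn).Term α} (h : TermEq T s t) {M : Type*}
    [(lang Fn).Structure M] (hM : M ⊨ eqTheory Fn T) (v : α → M) : s.realize v = t.realize v := by
  induction h with
  | refl t => rfl
  | symm _ ih => exact ih.symm
  | trans _ _ ih₁ ih₂ => exact ih₁.trans ih₂
  | congr f ss ts _ ih => simp only [Term.realize, ih]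
  | perm h x y z =>
    simp only [realize_cons]
    exact realize_permAxiom (hM.realize_of_mem _ (.inl ⟨h, rfl⟩)) _ _ _
  | abs h x y =>
    simp only [realize_cons]
    exact realize_absAxiom (hM.realize_of_mem _ (.inr ⟨h, rfl⟩)) _ _

theorem TermEq.models {s t : (lang Fn).Term α} (h : TermEq T s t) :
    eqTheory Fn T ⊨ᵇ Term.equal s t := by
  rw [Theory.models_formula_iff]
  intro M v
  exact Formula.realize_equal.2 (h.realize_eq M.is_model v)

theorem TermEq.tailVar_eq {s t : (lang Fn).Term α} (h : TermEq T s t) :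
    tailVar s = tailVar t := by
  induction h with
  | refl t => rfl
  | symm _ ih => exact ih.symm
  | trans _ _ ih₁ ih₂ => exact ih₁.trans ih₂
  | congr f ss ts _ ih => simp only [tailVar, ih]
  | perm h x y z => rfl
  | abs h x y => rfl

theorem Equ.rank_eq {s t : Herbrand Fn} (h : Equ T s t) : rank s = rank t := by
  induction h with
  | refl t => rfl
  | symm _ ih => exact ih.symm
  | trans _ _ ih₁ ih₂ => exact ih₁.trans ih₂
  | congr f ss ts _ ih => simp only [rank, ih]
  | perm h x y z => simp only [rank_cons]; omega
  | abs h x y => simp only [rank_cons]; omega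

theorem Equ.isElem_iff {s t : Herbrand Fn} (h : Equ T s t) (a : Herbrand Fn) :
    IsElem T a s ↔ IsElem T a t := by
  induction h with
  | refl t => rfl
  | symm _ ih => exact ih.symm
  | trans _ _ ih₁ ih₂ => exact ih₁.trans ih₂
  | congr f ss ts hst ih =>
    cases (f : FunSym Fn _) with
    | nil => rfl
    | cons =>
      exact or_congr ⟨fun h => h.trans (hst 0), fun h => h.trans (hst 0).symm⟩ (ih 1)
    | free f => rfl
  | perm h x y z => simp only [isElem_cons]; tauto
  | abs h x y => simp only [isElem_cons]; tauto

theorem isElem_consList {a r : Herbrand Fn} {ts : List (Herbrand Fn)} :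
    IsElem T a (consList ts r) ↔ (∃ t ∈ ts, Equ T a t) ∨ IsElem T a r := by
  induction ts with
  | nil => simp [consList]
  | cons b ts ih =>
    have : IsElem T a (consList (b :: ts) r) ↔ Equ T a b ∨ IsElem T a (consList ts r) := Iff.rfl
    rw [this, ih]
    simp [or_assoc]

theorem MemGround.isElem {a s : Herbrand Fn} (h : MemGround T a s) : IsElem T a s := by
  obtain ⟨ts, r, h⟩ := h
  rw [← h.isElem_iff, isElem_consList]
  exact .inl ⟨a, by simp, .refl a⟩

theorem memGround_consList {a : Herbrand Fn} {ts : List (Herbrand Fn)} (h : a ∈ ts)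
    (r : Herbrand Fn) : MemGround T a (consList ts r) := by
  obtain ⟨l₁, l₂, rfl⟩ := List.append_of_mem h
  refine ⟨l₁, consList l₂ r, ?_⟩
  simp only [consList, List.foldr_append, List.foldr_cons, List.foldr_nil]
  exact .refl _

theorem tailVar_consList (ts : List ((lang Fn).Term α)) (r : (lang Fn).Term α) :
    tailVar (consList ts r) = tailVar r := by
  induction ts with
  | nil => rfl
  | cons b ts ih => exact ih

theorem tailVar_mem_varFinset [DecidableEq α] {t : (lang Fn).Term α} {x : α}
    (h : tailVar t = some x) : x ∈ t.varFinset := by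
  induction t using term_induction with
  | var y => simpa [tailVar, eq_comm] using h
  | nil => cases h
  | cons s t _ ih =>
    exact Finset.mem_biUnion.2 ⟨1, Finset.mem_univ _, ih h⟩
  | free f ts _ => cases h

/-- The end of an instance is the end of the instance of the end. -/
theorem tailVar_subst {t : (lang Fn).Term α} {σ : α → (lang Fn).Term β} :
    tailVar (t.subst σ) = (tailVar t).bind fun x => tailVar (σ x) := by
  induction t using term_induction with
  | var y => rfl
  | nil => rfl
  | cons s t _ ih => rw [cons_subst]; exact ih
  | free f ts _ => rfl

theorem subst_subst {γ : Type*} (t : (lang Fn).Term α) (σ : α → (lang Fn).Term β)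
    (θ : β → (lang Fn).Term γ) : (t.subst σ).subst θ = t.subst fun x => (σ x).subst θ := by
  induction t with
  | var => rfl
  | func f ts ih => simp only [Term.subst, ih]

theorem subst_congr [DecidableEq α] {t : (lang Fn).Term α} {σ τ : α → (lang Fn).Term β}
    (h : ∀ x ∈ t.varFinset, σ x = τ x) : t.subst σ = t.subst τ := by
  induction t with
  | var x => exact h x (by simp [Term.varFinset])
  | func f ts ih =>
    simp only [Term.subst]
    congr 1
    funext i
    exact ih i fun x hx => h x (Finset.mem_biUnion.2 ⟨i, Finset.mem_univ _, hx⟩)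

theorem relabel_eq_self [DecidableEq α] {t : (lang Fn).Term α} {g : α → α}
    (h : ∀ x ∈ t.varFinset, g x = x) : t.relabel g = t := by
  induction t with
  | var x => exact congrArg _ (h x (by simp [Term.varFinset]))
  | func f ts ih =>
    simp only [Term.relabel]
    congr 1
    funext i
    exact ih i fun x hx => h x (Finset.mem_biUnion.2 ⟨i, Finset.mem_univ _, hx⟩)

end TermEq

/-! ### Generic ground substitutions -/

section Generic

variable {Fn : ℕ → Type u} {α : Type v} {T : Agg}

theorem setTail_setTail (m n : ℕ) (t : (lang Fn).Term ℕ) :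
    setTail m (setTail n t) = setTail (max m n) t := by
  induction t using term_induction with
  | var k => exact congrArg _ (max_assoc m n k).symm
  | nil => rfl
  | cons s t _ ih => simp only [setTail_cons, ih]
  | free f ts _ => rfl

theorem TermEq.setTail {s t : (lang Fn).Term ℕ} (h : TermEq T s t) (n : ℕ) :
    TermEq T (setTail n s) (setTail n t) := by
  induction h with
  | refl t => exact .refl _
  | symm _ ih => exact ih.symm
  | trans _ _ ih₁ ih₂ => exact ih₁.trans ih₂
  | congr f ss ts hst ih =>
    cases (f : FunSym Fn _) with
    | nil => exact .refl _
    | cons => exact (hst 0).cons_congr (ih 1)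
    | free f => exact .refl _
  | perm h x y z => exact TermEq.perm h _ _ _
  | abs h x y => exact TermEq.abs h _ _

/-- Decoding is compatible with the congruences. -/
theorem Equ.decode {s t : Herbrand Fn} (h : Equ T s t) (N : ℕ) :
    TermEq T (decode N s) (decode N t) := by
  induction h with
  | refl t => exact .refl _
  | symm _ ih => exact ih.symm
  | trans _ _ ih₁ ih₂ => exact ih₁.trans ih₂
  | congr f ss ts hst ih =>
    cases (f : FunSym Fn _) with
    | nil => exact .refl _
    | cons =>
      change TermEq T (Aggregates.decode N (cons (ss 0) (ss 1)))
        (Aggregates.decode N (cons (ts 0) (ts 1)))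
      rw [decode_cons, decode_cons, (hst 0).rank_eq]
      split_ifs
      · exact (ih 1).setTail _
      · exact (ih 0).cons_congr (ih 1)
    | free f => exact .congr _ _ _ ih
  | perm h x y z =>
    simp only [decode_cons]
    split_ifs
    · rw [setTail_setTail, setTail_setTail, max_comm]
      exact .refl _
    · exact .refl _
    · exact .refl _
    · exact .perm h _ _ _
  | abs h x y =>
    simp only [decode_cons]
    split_ifs
    · rw [setTail_setTail, max_self]
      exact .refl _
    · exact .abs h _ _

/-- The nested aggregate `{{…{nil | nil}… | nil} | nil}` with `n` pairs of braces. -/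
def nested (Fn : ℕ → Type u) : ℕ → Herbrand Fn
  | 0 => nil
  | n + 1 => cons (nested Fn n) nil

@[simp]
theorem rank_nested (n : ℕ) : rank (nested Fn n) = n := by
  induction n with
  | zero => rfl
  | succ n ih => simp [nested, ih]

/-- The code of the variable `n`: a singleton whose element has rank `N * (n + 1)`. -/
def code (Fn : ℕ → Type u) (N n : ℕ) : Herbrand Fn :=
  cons (nested Fn (N * (n + 1))) nil

theorem rank_code (N n : ℕ) : rank (code Fn N n) = N * (n + 1) + 1 := by
  simp [code]

theorem succ_mod_le {x d N : ℕ} (h : x % N ≤ d) (hd : d + 1 < N) :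
    (x + 1) % N ≤ d + 1 ∧ ¬ N ∣ x + 1 := by
  have : (x + 1) % N = x % N + 1 := by
    rw [Nat.add_mod, Nat.mod_eq_of_lt (by omega : 1 < N), Nat.mod_eq_of_lt (by omega)]
  exact ⟨by omega, fun hN => by have := Nat.mod_eq_zero_of_dvd hN; omega⟩

/-- The instance of a small term under a coding substitution has a rank that lies closely above a
multiple of `N`, and is not itself a positive multiple of `N`. -/
theorem rank_subst_code {N : ℕ} (i : α → ℕ) {t : (lang Fn).Term α} (ht : rank t + 2 ≤ N) :
    rank (t.subst fun x => code Fn N (i x)) % N ≤ rank t + 1 ∧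
      (N ∣ rank (t.subst fun x => code Fn N (i x)) →
        rank (t.subst fun x => code Fn N (i x)) = 0) := by
  induction t using term_induction with
  | var x =>
    change rank (code Fn N (i x)) % N ≤ 0 + 1 ∧ (N ∣ rank (code Fn N (i x)) → _)
    rw [rank_code, Nat.mul_add_mod, Nat.mod_eq_of_lt (by omega : 1 < N)]
    refine ⟨le_rfl, fun h => ?_⟩
    have := (Nat.dvd_add_right (Nat.dvd_mul_right N _)).1 h
    have := Nat.le_of_dvd one_pos this
    omega
  | nil => simp
  | cons s t ihs iht =>
    rw [rank_cons] at ht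
    obtain ⟨hs, -⟩ := ihs (by omega)
    obtain ⟨ht₁, ht₂⟩ := iht (by omega)
    simp only [cons_subst, rank_cons]
    obtain ⟨h₁, h₂⟩ := succ_mod_le hs (by omega)
    rcases max_choice (rank (s.subst fun x => code Fn N (i x)) + 1)
      (rank (t.subst fun x => code Fn N (i x))) with h | h <;> rw [h]
    · exact ⟨by omega, fun h => absurd h h₂⟩
    · exact ⟨by omega, ht₂⟩
  | @free n f ts ih =>
    have hsup : (Finset.univ.sup fun j => rank ((ts j).subst fun x => code Fn N (i x))) % N ≤
        (Finset.univ.sup fun j => rank (ts j)) + 1 := by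
      rcases isEmpty_or_nonempty (Fin n) with h | h
      · simp
      · obtain ⟨j, -, hj⟩ := Finset.exists_mem_eq_sup Finset.univ Finset.univ_nonempty
          fun j => rank ((ts j).subst fun x => code Fn N (i x))
        have hle : rank (ts j) ≤ Finset.univ.sup fun j => rank (ts j) :=
          Finset.le_sup (f := fun j => rank (ts j)) (Finset.mem_univ j)
        rw [hj]
        exact (ih j (by rw [rank_free] at ht; omega)).1.trans (by omega)
    rw [rank_free] at ht ⊢
    obtain ⟨h₁, h₂⟩ := succ_mod_le hsup (by omega)
    exact ⟨h₁, fun h => absurd h h₂⟩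

/-- Decoding inverts coding on small terms. The bound on the rank of `t` makes sure that no element in
`t` is mistaken for the mark of a variable. -/
theorem decode_subst_code {N : ℕ} (i : α → ℕ) {t : (lang Fn).Term α} (ht : rank t + 2 ≤ N) :
    decode N (t.subst fun x => code Fn N (i x)) = t.relabel i := by
  induction t using term_induction with
  | var x =>
    change decode N (code Fn N (i x)) = .var (i x)
    have hN : 0 < N := by omega
    rw [code, decode_cons, rank_nested, if_pos ⟨Nat.dvd_mul_right _ _, by positivity⟩,
      Nat.mul_div_cancel_left _ hN]
    rfl
  | nil => rw [nil_subst, nil_relabel]; rfl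
  | cons s t ihs iht =>
    rw [rank_cons] at ht
    rw [cons_subst, decode_cons, cons_relabel, ihs (by omega), iht (by omega), if_neg]
    exact fun h => h.2 ((rank_subst_code i (by omega)).2 h.1)
  | free f ts ih =>
    refine congrArg (Term.func (FunSym.free f)) (funext fun j => ih j ?_)
    have hle : rank (ts j) ≤ Finset.univ.sup fun j => rank (ts j) :=
      Finset.le_sup (f := fun j => rank (ts j)) (Finset.mem_univ j)
    rw [rank_free] at ht
    omega

theorem not_isElem_code {N : ℕ} (i : α → ℕ) {t : (lang Fn).Term α} (ht : rank t + 2 ≤ N)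
    (n : ℕ) : ¬ IsElem T (t.subst fun x => code Fn N (i x)) (code Fn N n) := by
  rintro (h | h)
  · have h := h.rank_eq
    change _ = rank (nested Fn _) at h
    rw [rank_nested] at h
    have := (rank_subst_code i ht).2 ⟨_, h⟩
    have : 0 < N * (n + 1) := Nat.mul_pos (by omega) n.succ_pos
    omega
  · exact h

/-- Finitely many terms have a ground instance that keeps all of them different that are different
modulo `E_T`, and in which no value of a variable has any of them as an element. -/
theorem exists_generic_subst [Nonempty α] (T : Agg) (L : List ((lang Fn).Term α)) :
    ∃ θ : α → Herbrand Fn,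
      (∀ a ∈ L, ∀ b ∈ L, Equ T (a.subst θ) (b.subst θ) → TermEq T a b) ∧
        ∀ a ∈ L, ∀ x, ¬ IsElem T (a.subst θ) (θ x) := by
  classical
  let W : Finset α := L.toFinset.biUnion Term.varFinset
  have hW : ∀ a ∈ L, ∀ x ∈ a.varFinset, x ∈ W := fun a ha x hx =>
    Finset.mem_biUnion.2 ⟨a, List.mem_toFinset.2 ha, hx⟩
  obtain ⟨i, hi⟩ := Set.countable_iff_exists_injOn.1 W.finite_toSet.countable
  let N := (L.map rank).sum + 2
  have hN : ∀ a ∈ L, rank a + 2 ≤ N := fun a ha =>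
    Nat.add_le_add_right (List.le_sum_of_mem (List.mem_map_of_mem ha)) 2
  have hinv : ∀ a ∈ L, (a.relabel i).relabel (Function.invFunOn i W) = a := fun a ha => by
    rw [Term.relabel_relabel]
    exact relabel_eq_self fun x hx => hi.leftInvOn_invFunOn (hW a ha x hx)
  refine ⟨fun x => code Fn N (i x), fun a ha b hb h => ?_, fun a ha x =>
    not_isElem_code i (hN a ha) _⟩
  have h := h.decode N
  rw [decode_subst_code i (hN a ha), decode_subst_code i (hN b hb)] at h
  rw [← hinv a ha, ← hinv b hb]
  exact h.relabel _

end Generic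

/-! ### Closure of the member substitution -/

section Closure

variable {Fn : ℕ → Type u} {V : Type v}

theorem Subst.pow_of_eq_var {σ : Subst Fn V} {X : V} (h : σ X = .var X) (n : ℕ) :
    σ.pow n X = .var X := by
  induction n with
  | zero => rfl
  | succ n ih => simp only [Subst.pow, h, Term.subst, ih]

theorem Subst.closure_eq {σ : Subst Fn V} (h : σ.Stabilizing) (X : V) :
    σ.closure X = (σ X).subst σ.closure := by
  obtain ⟨m, -, hm, hk⟩ := closure_spec h
  rw [hm]
  exact (congrFun (hk (m + 1) m.lt_succ_self) X).symm

theorem Subst.closure_of_eq_var {σ : Subst Fn V} (h : σ.Stabilizing) {X : V} (hX : σ X = .var X) :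
    σ.closure X = .var X := by
  obtain ⟨m, -, hm, -⟩ := closure_spec h
  rw [hm, pow_of_eq_var hX]

variable [DecidableEq V] {C : Constraint Fn V}

theorem Constraint.mem_members {X : V} {t : (lang Fn).Term V} :
    t ∈ C.members X ↔ Literal.mem t (.var X) ∈ C := by
  rw [Constraint.members, List.mem_filterMap]
  constructor
  · rintro ⟨c, hc, h⟩
    split at h
    · rename_i s Y
      split_ifs at h with hY
      · obtain rfl := Option.some.inj h
        rwa [← hY]
    · cases h
  · exact fun h => ⟨_, h, by simp⟩

theorem Constraint.mem_vars_mem {X Y : V} {t : (lang Fn).Term V}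
    (h : Literal.mem t (.var X) ∈ C) (hY : Y ∈ t.varFinset) : C.Occurs Y :=
  ⟨_, h, Finset.mem_union_left _ hY⟩

theorem Constraint.members_eq_nil {X : V} (h : ¬ C.Occurs X) : C.members X = [] :=
  List.eq_nil_iff_forall_not_mem.2 fun _ ht =>
    h ⟨_, mem_members.1 ht, Finset.mem_union_right _ (by simp [Term.varFinset])⟩

theorem Constraint.memberSubst_of_nil {X : V} {F M : V → V} (h : C.members X = []) :
    C.memberSubst F M X = .var X :=
  if_pos h

theorem Constraint.memberSubst_of_ne_nil {X : V} {F M : V → V} (h : C.members X ≠ []) :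
    C.memberSubst F M X = consList (.var (F X) :: C.members X) (.var (M X)) :=
  if_neg h

/-- The number of variables from which there is a path to `X` in the membership graph. -/
noncomputable def Constraint.height (C : Constraint Fn V) (X : V) : ℕ :=
  {Y | Relation.TransGen C.Edge Y X}.ncard

theorem Constraint.finite_occurs (C : Constraint Fn V) : {X | C.Occurs X}.Finite := by
  refine (C.finite_toSet.biUnion fun c _ => c.vars.finite_toSet).subset ?_
  rintro X ⟨c, hc, hX⟩
  exact Set.mem_biUnion hc hX

theorem Constraint.finite_path (C : Constraint Fn V) (X : V) :
    {Y | Relation.TransGen C.Edge Y X}.Finite := by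
  refine (Constraint.finite_occurs C).subset fun Y hY => ?_
  obtain ⟨Z, ⟨t, ht, hYt⟩, -⟩ := Relation.TransGen.head'_iff.1 hY
  exact mem_vars_mem ht hYt

theorem Constraint.height_lt (hC : C.Acyclic) {X Y : V} (h : C.Edge Y X) :
    C.height Y < C.height X :=
  Set.ncard_lt_ncard
    ⟨fun _ hZ => hZ.tail h, fun hsub => hC Y (hsub (Relation.TransGen.single h))⟩
    (C.finite_path X)

theorem Constraint.height_le (C : Constraint Fn V) (X : V) :
    C.height X ≤ {X | C.Occurs X}.ncard := by
  refine Set.ncard_le_ncard (fun Y hY => ?_) (Constraint.finite_occurs C)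
  obtain ⟨Z, ⟨t, ht, hYt⟩, -⟩ := Relation.TransGen.head'_iff.1 hY
  exact mem_vars_mem ht hYt

/-- On a variable of height less than `n`, the powers of the member substitution are constant from
the exponent `n` on. -/
theorem Constraint.pow_memberSubst_eq (hC : C.Acyclic) {F M : V → V} (hF : C.Fresh F M) (n : ℕ) :
    ∀ X : V, C.height X < n →
      (C.memberSubst F M).pow (n + 1) X = (C.memberSubst F M).pow n X := by
  induction n with
  | zero => exact fun X hX => absurd hX (Nat.not_lt_zero _)
  | succ n ih =>
    intro X hX
    by_cases hm : C.members X = []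
    · rw [Subst.pow_of_eq_var (memberSubst_of_nil hm), Subst.pow_of_eq_var (memberSubst_of_nil hm)]
    · have hvar : ∀ (Y : V) (k : ℕ), ¬ C.Occurs Y → (C.memberSubst F M).pow k Y = .var Y :=
        fun Y k hY => Subst.pow_of_eq_var (memberSubst_of_nil (members_eq_nil hY)) k
      change (C.memberSubst F M X).subst ((C.memberSubst F M).pow (n + 1)) =
        (C.memberSubst F M X).subst ((C.memberSubst F M).pow n)
      rw [memberSubst_of_ne_nil hm, consList_subst, consList_subst, List.map_cons, List.map_cons]
      simp only [Term.subst, hvar _ _ (hF.F_new X hm), hvar _ _ (hF.M_new X hm)]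
      congr 2
      refine List.map_congr_left fun t ht => subst_congr fun Y hY => ih Y ?_
      have := C.height_lt hC ⟨t, mem_members.1 ht, hY⟩
      omega

theorem Constraint.stabilizing_memberSubst (hC : C.Acyclic) {F M : V → V} (hF : C.Fresh F M) :
    (C.memberSubst F M).Stabilizing :=
  ⟨_, Nat.succ_pos _, funext fun X =>
    pow_memberSubst_eq hC hF _ X (Nat.lt_succ_of_le (C.height_le X))⟩

theorem Constraint.closure_of_nil (hC : C.Acyclic) {F M : V → V} (hF : C.Fresh F M) {X : V}
    (hX : C.members X = []) : (C.memberSubst F M).closure X = .var X :=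
  Subst.closure_of_eq_var (stabilizing_memberSubst hC hF) (memberSubst_of_nil hX)

theorem Constraint.closure_of_ne_nil (hC : C.Acyclic) {F M : V → V} (hF : C.Fresh F M) {X : V}
    (hX : C.members X ≠ []) :
    (C.memberSubst F M).closure X = consList
      (.var (F X) :: (C.members X).map fun t => t.subst (C.memberSubst F M).closure)
      (.var (M X)) := by
  rw [Subst.closure_eq (stabilizing_memberSubst hC hF), memberSubst_of_ne_nil hX, consList_subst,
    List.map_cons]
  simp only [Term.subst, closure_of_nil hC hF (members_eq_nil (hF.F_new X hX)),
    closure_of_nil hC hF (members_eq_nil (hF.M_new X hX))]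

/-- The closure of the member substitution is injective on the variables of the constraint, already
when only the variables at the ends of the values are compared. -/
theorem Constraint.tailVar_closure_inj (hC : C.Acyclic) {F M : V → V} (hF : C.Fresh F M) {X Y : V}
    (hX : C.Occurs X) (hY : C.Occurs Y)
    (h : tailVar ((C.memberSubst F M).closure X) = tailVar ((C.memberSubst F M).closure Y)) :
    X = Y := by
  by_cases hmX : C.members X = [] <;> by_cases hmY : C.members Y = []
  · rw [closure_of_nil hC hF hmX, closure_of_nil hC hF hmY] at h
    exact Option.some.inj h
  · rw [closure_of_nil hC hF hmX, closure_of_ne_nil hC hF hmY, tailVar_consList] at h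
    exact absurd (Option.some.inj h ▸ hX) (hF.M_new Y hmY)
  · rw [closure_of_ne_nil hC hF hmX, closure_of_nil hC hF hmY, tailVar_consList] at h
    exact absurd (Option.some.inj h ▸ hY) (hF.M_new X hmX)
  · rw [closure_of_ne_nil hC hF hmX, closure_of_ne_nil hC hF hmY, tailVar_consList,
      tailVar_consList] at h
    exact hF.M_inj X Y hmX hmY (Option.some.inj h)

/-- A literal `X ≠ t` in which `X` does not occur in `t` holds identically after applying the
closure of the member substitution. -/
theorem Constraint.not_termEq_closure {T : Agg} (hC : C.Acyclic) {F M : V → V} (hF : C.Fresh F M)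
    {X : V} {t : (lang Fn).Term V} (hX : C.Occurs X) (ht : ∀ Y ∈ t.varFinset, C.Occurs Y)
    (hXt : X ∉ t.varFinset) :
    ¬ TermEq T ((C.memberSubst F M).closure X) (t.subst (C.memberSubst F M).closure) := by
  intro h
  have h := h.tailVar_eq
  rw [tailVar_subst] at h
  cases hY : tailVar t with
  | none =>
    rw [hY] at h
    by_cases hm : C.members X = []
    · rw [closure_of_nil hC hF hm] at h
      cases h
    · rw [closure_of_ne_nil hC hF hm, tailVar_consList] at h
      cases h
  | some Y =>
    rw [hY] at h
    have hY := tailVar_mem_varFinset hY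
    exact hXt (tailVar_closure_inj hC hF hX (ht Y hY) h ▸ hY)

/-- The new elements `F X` are different from the instances of all terms of the constraint. -/
theorem Constraint.not_termEq_new {T : Agg} (hC : C.Acyclic) {F M : V → V} (hF : C.Fresh F M)
    {X : V} (hX : C.members X ≠ []) {t : (lang Fn).Term V} (ht : ∀ Y ∈ t.varFinset, C.Occurs Y) :
    ¬ TermEq T (t.subst (C.memberSubst F M).closure) (.var (F X)) := by
  intro h
  have h := h.tailVar_eq
  rw [tailVar_subst] at h
  cases hY : tailVar t with
  | none =>
    rw [hY] at h
    cases h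
  | some Y =>
    rw [hY] at h
    have hY := ht Y (tailVar_mem_varFinset hY)
    change tailVar ((C.memberSubst F M).closure Y) = some (F X) at h
    by_cases hm : C.members Y = []
    · rw [closure_of_nil hC hF hm] at h
      exact hF.F_new X hX (Option.some.inj h ▸ hY)
    · rw [closure_of_ne_nil hC hF hm, tailVar_consList] at h
      exact hF.F_ne_M X Y hX hm (Option.some.inj h).symm

end Closure

/-! ### Satisfiability in the privileged model -/

section Satisfiability

variable {Fn : ℕ → Type u} {V : Type v} {T : Agg}

theorem realize_privModel (g : V → Herbrand Fn) (t : (lang Fn).Term V) :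
    (t.realize fun X => (Quotient.mk _ (g X) : PrivModel Fn T)) = Quotient.mk _ (t.subst g) := by
  rw [Term.realize_quotient_mk' (herbrandSetoid Fn T) t g]
  congr 1
  induction t with
  | var => rfl
  | func f ts ih => exact congrArg (Term.func f) (funext ih)

/-- Truth of a literal under a ground substitution, modulo `E_T`. -/
def Literal.Holds (T : Agg) (g : V → Herbrand Fn) : Literal Fn V → Prop
  | .eq s t => Equ T (s.subst g) (t.subst g)
  | .mem s t => MemGround T (s.subst g) (t.subst g)
  | .ne s t => ¬ Equ T (s.subst g) (t.subst g)
  | .nmem s t => ¬ MemGround T (s.subst g) (t.subst g)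

theorem realize_equal_privModel (g : V → Herbrand Fn) (s t : (lang Fn).Term V) :
    (Term.equal s t).Realize (fun X => (Quotient.mk _ (g X) : PrivModel Fn T)) ↔
      Equ T (s.subst g) (t.subst g) := by
  rw [Formula.realize_equal, realize_privModel, realize_privModel, Quotient.eq]
  rfl

theorem realize_memFormula_privModel (g : V → Herbrand Fn) (s t : (lang Fn).Term V) :
    (memFormula s t).Realize (fun X => (Quotient.mk _ (g X) : PrivModel Fn T)) ↔
      MemGround T (s.subst g) (t.subst g) := by
  rw [memFormula, Formula.realize_rel₂, realize_privModel, realize_privModel]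
  have : (![Quotient.mk _ (s.subst g), Quotient.mk _ (t.subst g)] : Fin 2 → PrivModel Fn T) =
      fun i => Quotient.mk _ (![s.subst g, t.subst g] i) := by
    funext i
    fin_cases i <;> rfl
  rw [this]
  exact relMap_quotient_mk' (herbrandSetoid Fn T) memSym ![s.subst g, t.subst g]

theorem Literal.realize_iff (g : V → Herbrand Fn) (c : Literal Fn V) :
    c.toFormula.Realize (fun X => (Quotient.mk _ (g X) : PrivModel Fn T)) ↔ c.Holds T g := by
  cases c with
  | eq s t => exact realize_equal_privModel g s t
  | mem s t => exact realize_memFormula_privModel g s t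
  | ne s t => exact not_congr (realize_equal_privModel g s t)
  | nmem s t => exact not_congr (realize_memFormula_privModel g s t)

theorem Constraint.satisfiable_of_holds {C : Constraint Fn V} (g : V → Herbrand Fn)
    (h : ∀ c ∈ C, c.Holds T g) : C.Satisfiable T := by
  refine ⟨fun X => Quotient.mk _ (g X), ?_⟩
  refine (BoundedFormula.realize_foldr_inf _ _ _).2 fun φ hφ => ?_
  obtain ⟨c, hc, rfl⟩ := List.mem_map.1 hφ
  exact (Literal.realize_iff g c).2 (h c hc)

variable [DecidableEq V] {C : Constraint Fn V}

theorem Literal.holds_congr {g g' : V → Herbrand Fn} {c : Literal Fn V}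
    (h : ∀ X ∈ c.vars, g X = g' X) : c.Holds T g ↔ c.Holds T g' := by
  have key : ∀ s t : (lang Fn).Term V, (∀ X ∈ s.varFinset ∪ t.varFinset, g X = g' X) →
      s.subst g = s.subst g' ∧ t.subst g = t.subst g' := fun s t h =>
    ⟨subst_congr fun X hX => h X (Finset.mem_union_left _ hX),
      subst_congr fun X hX => h X (Finset.mem_union_right _ hX)⟩
  cases c with
  | eq s t | mem s t | ne s t | nmem s t =>
    simp only [Holds, (key s t h).1, (key s t h).2]

theorem Constraint.PreSolved.eq_of_mem_vars (h : C.PreSolved) {X : V} {t : (lang Fn).Term V}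
    (hX : Literal.eq (.var X) t ∈ C) {c : Literal Fn V} (hc : c ∈ C) (hXc : X ∈ c.vars) :
    c = .eq (.var X) t := by
  obtain ⟨i, hi⟩ := List.mem_iff_get.1 hX
  obtain ⟨j, rfl⟩ := List.mem_iff_get.1 hc
  obtain ⟨Y, s, -, ⟨hY, h⟩ | h | h | h⟩ := h i
  · rw [hi] at hY
    cases hY
    by_contra hne
    refine h j ?_ hXc
    rintro rfl
    exact hne hi
  all_goals
    rw [hi] at h
    cases h

theorem Constraint.PreSolved.notMem_of_eq (h : C.PreSolved) {X : V} {t : (lang Fn).Term V}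
    (hX : Literal.eq (.var X) t ∈ C) : X ∉ t.varFinset := by
  obtain ⟨i, hi⟩ := List.mem_iff_get.1 hX
  obtain ⟨Y, s, hYs, ⟨h, -⟩ | h | h | h⟩ := h i <;> rw [hi] at h <;> cases h
  exact hYs

/-- The conjuncts `X = t` of a pre-solved constraint can be satisfied after the others. -/
theorem Constraint.PreSolved.satisfiable (h : C.PreSolved) (g : V → Herbrand Fn)
    (hg : ∀ c ∈ C, (∀ s t, c ≠ .eq s t) → c.Holds T g) : C.Satisfiable T := by
  classical
  let g' : V → Herbrand Fn := fun X =>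
    if hX : ∃ t, Literal.eq (.var X) t ∈ C then hX.choose.subst g else g X
  refine satisfiable_of_holds g' fun c hc => ?_
  by_cases hceq : ∃ s t, c = .eq s t
  · obtain ⟨s, t, rfl⟩ := hceq
    obtain ⟨X, rfl⟩ : ∃ X, s = .var X := by
      obtain ⟨i, hi⟩ := List.mem_iff_get.1 hc
      obtain ⟨X, t', -, ⟨h, -⟩ | h | h | h⟩ := h i <;> rw [hi] at h <;> cases h
      exact ⟨X, rfl⟩
    have hex : ∃ t, Literal.eq (.var X) t ∈ C := ⟨t, hc⟩
    have hchoose : hex.choose = t := by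
      have := h.eq_of_mem_vars hc hex.choose_spec (by simp [Literal.vars, Term.varFinset])
      injection this
    have ht : t.subst g' = t.subst g := subst_congr fun Y hY => by
      refine dif_neg ?_
      rintro ⟨s, hs⟩
      have := h.eq_of_mem_vars hs hc (Finset.mem_union_right _ hY)
      cases this
      exact h.notMem_of_eq hc hY
    have hX : g' X = t.subst g := by rw [← hchoose]; exact dif_pos hex
    change Equ T (g' X) (t.subst g')
    rw [hX, ht]
    exact .refl _
  · have hne : ∀ s t, c ≠ .eq s t := fun s t h => hceq ⟨s, t, h⟩
    refine (Literal.holds_congr fun X hX => ?_).2 (hg c hc hne)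
    exact dif_neg fun ⟨t, ht⟩ => hne _ _ (h.eq_of_mem_vars ht hc hX)

/-- The two terms of a literal. -/
def Literal.terms : Literal Fn V → List ((lang Fn).Term V)
  | .eq s t => [s, t]
  | .mem s t => [s, t]
  | .ne s t => [s, t]
  | .nmem s t => [s, t]

/-- The satisfying valuation is `X ↦ θ (σ* X)`, where `σ*` is the closure of the member substitution
and `θ` is generic for the instances of all terms of `C` and for the new variables `F X`. -/
theorem Constraint.Solved.satisfiable [Nonempty V] (hC : C.Solved T) : C.Satisfiable T := by
  obtain ⟨hpre, hacyc, F, M, hF, hcons⟩ := hC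
  let σ := (C.memberSubst F M).closure
  obtain ⟨θ, hθ, hθ'⟩ := exists_generic_subst T
    ((C.flatMap Literal.terms).map (fun t => t.subst σ) ++
      (Constraint.finite_occurs C).toFinset.toList.map fun X => .var (F X))
  have hL : ∀ {c t}, c ∈ C → t ∈ c.terms → t.subst σ ∈
      (C.flatMap Literal.terms).map (fun t => t.subst σ) ++
        (Constraint.finite_occurs C).toFinset.toList.map fun X => .var (F X) := fun hc ht =>
    List.mem_append_left _ (List.mem_map_of_mem (List.mem_flatMap.2 ⟨_, hc, ht⟩))
  have hsub : ∀ t : (lang Fn).Term V,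
      (t.subst fun X => (σ X).subst θ) = (t.subst σ).subst θ := fun t =>
    (subst_subst t σ θ).symm
  refine hpre.satisfiable (fun X => (σ X).subst θ) fun c hc hne => ?_
  obtain ⟨i, hi⟩ := List.mem_iff_get.1 hc
  obtain ⟨X, t, hXt, ⟨h, -⟩ | h | h | h⟩ := hpre i <;> rw [hi] at h <;> subst h
  · exact absurd rfl (hne _ _)
  · -- By construction `t` is one of the elements of the value of `X`.
    have hm : t ∈ C.members X := mem_members.2 hc
    change MemGround T (t.subst _) ((σ X).subst θ)
    rw [hsub, show σ X = _ from closure_of_ne_nil hacyc hF (List.ne_nil_of_mem hm),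
      consList_subst]
    have hmem : t.subst σ ∈ Language.var (F X) :: (C.members X).map fun t => t.subst σ :=
      List.mem_cons_of_mem _ (List.mem_map.2 ⟨t, hm, rfl⟩)
    exact memGround_consList (List.mem_map_of_mem (f := fun s => s.subst θ) hmem) _
  · -- Genericity reduces `X ≠ t` to the open terms `σ* X` and `σ* t`, which have different ends.
    intro h
    change Equ T ((σ X).subst θ) (t.subst _) at h
    rw [hsub] at h
    refine not_termEq_closure hacyc hF ⟨_, hc, ?_⟩ (fun Y hY => ⟨_, hc, ?_⟩) hXt
      (hθ (σ X) (hL (t := .var X) hc ?_) _ (hL hc ?_) h)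
    · simp [Literal.vars, Term.varFinset]
    · simp [Literal.vars, hY]
    · simp [Literal.terms]
    · simp [Literal.terms]
  · -- The elements of `θ (σ* X)` are `θ (F X)`, the `θ (σ* t')` for `t' ∈ X` in `C`, and that of the
    -- value of the variable at the end of `σ* X`.
    intro h
    have hX : C.Occurs X := ⟨_, hc, by simp [Literal.vars, Term.varFinset]⟩
    have ht : ∀ Y ∈ t.varFinset, C.Occurs Y := fun Y hY => ⟨_, hc, by simp [Literal.vars, hY]⟩
    have htL := hL (t := t) hc (by simp [Literal.terms])
    replace h : IsElem T (t.subst fun X => (σ X).subst θ) ((σ X).subst θ) := h.isElem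
    rw [hsub] at h
    by_cases hm : C.members X = []
    · rw [show σ X = _ from closure_of_nil hacyc hF hm] at h
      exact hθ' _ htL X h
    · rw [show σ X = _ from closure_of_ne_nil hacyc hF hm, consList_subst, isElem_consList] at h
      obtain ⟨s, hs, h⟩ | h := h
      · obtain ⟨s', hs', rfl⟩ := List.mem_map.1 hs
        obtain rfl | hs := List.mem_cons.1 hs'
        · refine not_termEq_new hacyc hF hm ht (hθ _ htL _ ?_ h)
          refine List.mem_append_right _ (List.mem_map.2 ⟨X, ?_, rfl⟩)
          simpa using hX
        · obtain ⟨t', ht', rfl⟩ := List.mem_map.1 hs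
          have ht' := mem_members.1 ht'
          exact hcons X t t' hc ht' (hθ _ htL _ (hL ht' (by simp [Literal.terms])) h).models
      · exact hθ' _ htL (M X) h

end Satisfiability

end Aggregates

theorem theorem2 {Fn : ℕ → Type*} {V : Type*} [DecidableEq V] [Infinite V]
    (T : Aggregates.Agg) (C : Aggregates.Constraint Fn V)
    (hC : Aggregates.Constraint.Solved T C) :
    Aggregates.Constraint.Satisfiable T C :=
  hC.satisfiable
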